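/- **Corollary (multiplexes are elementary).** Let $n\ge d\ge 2$. A $d$-dimensional *multiplex* $M^{d,n}$ is a $d$-dimensional convex polytope with an ordered list of distinct vertices $x_0,\dots,x_n$ (these being all its vertices) whose facets are exactly $$F_i=\operatorname{conv}\{x_{i-d+1},\dots,x_{i-1},x_{i+1},\dots,x_{i+d-1}\}\qquad(0\le i\le n),$$ where $x_j=x_0$ for $j<0$ and $x_j=x_n$ for $j>n$. The toric $h$-vector $(h_0,\dots,h_d)$ of a $d$-dimensional polytope $P$ is defined by the recursion $$\sum_{i=0}^{d}h_i\,t^{d-i}=\sum_{F\subsetneq P}g(F,t)\,(t-1)^{d-1-\dim F},\qquad g(\emptyset,t)=1,\qquad g(F,t)=\sum_{i=0}^{\lfloor \dim F/2\rfloor}\bigl(h_i(F)-h_{i-1}(F)\bigr)t^i,$$ where $F$ runs over all proper faces of $P$ including $\emptyset$ (with $\dim\emptyset=-1$), and $h_{-1}=0$. Let $f_i(P)$ be the number of $i$-dimensional faces of $P$, and $f_{02}(P)$ the number of pairs of a vertex and a $2$-dimensional face containing it; for $d=2$, $P$ itself counts as a $2$-dimensional face. Then every multiplex $P=M^{d,n}$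 with $n\ge d\ge 2$ is elementary, that is: 1. $f_{02}(P)-3f_2(P)+f_1(P)-d\,f_0(P)+\binom{d+1}{2}=0$; 2. if $d\ge 3$ or $n=d$, the toric $h$-vector of $P$ satisfies $h_1(P)=h_2(P)$. (For $d=2<n$, $P$ is an $(n+1)$-gon and its toric $h$-vector is $(1,n-1,1)$, so only condition 1 applies.) -/

import Mathlib

open Polynomial

/-! ### Toric polynomials of a finite ranked poset -/

section Toric

variable {L : Type*} [PartialOrder L] [Fintype L]

/-- For a polynomial `f = h_d + h_{d-1} X + ⋯ + h_0 X^d`, the polynomial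
`∑_{i ≤ d/2} (h_i - h_{i-1}) X^i`, where `h_{-1} = 0`. -/
noncomputable def toricTruncation (d : ℕ) (f : ℤ[X]) : ℤ[X] :=
  ∑ i ∈ Finset.range (d / 2 + 1),
    C (f.coeff (d - i) - if i = 0 then 0 else f.coeff (d - (i - 1))) * X ^ i

open Classical in
/-- The toric `g`-polynomial of the interval `[⊥, t]` of a finite poset with rank function `ρ`
(where `⊥` is the only element of rank `0`):
it is `1` if `t` has rank `0`; if `t` has rank `d + 1`, it is obtained by truncation from
`∑_{s < t} g(s) (X - 1)^{ρ(t) - ρ(s) - 1}`. -/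
noncomputable def toricG (ρ : L → ℕ) (t : L) : ℤ[X] :=
  if ρ t = 0 then 1 else
    toricTruncation (ρ t - 1)
      (∑ s : {s : L // s < t}, toricG ρ s.1 * (X - 1) ^ (ρ t - ρ s.1 - 1))
termination_by (wellFounded_lt (α := L)).wrap t
decreasing_by exact s.2

open Classical in
/-- The toric polynomial `f([⊥, t]) = ∑_{s < t} g([⊥, s]) (X - 1)^{ρ(t) - ρ(s) - 1}`. -/
noncomputable def toricF (ρ : L → ℕ) (t : L) : ℤ[X] :=
  ∑ s : {s : L // s < t}, toricG ρ s.1 * (X - 1) ^ (ρ t - ρ s.1 - 1)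

end Toric

/-! ### Convex polytopes and their face lattices -/

section Polytopes

variable {E : Type*} [NormedAddCommGroup E] [NormedSpace ℝ E]

/-- A convex polytope: the convex hull of a finite set of points. -/
structure ConvexPolytope (E : Type*) [NormedAddCommGroup E] [NormedSpace ℝ E] where
  /-- The underlying point set. -/
  carrier : Set E
  exists_finite : ∃ V : Set E, V.Finite ∧ carrier = convexHull ℝ V

open Classical in
/-- The dimension of (the affine span of) a set, plus one; `0` for the empty set. -/
noncomputable def dimSucc (F : Set E) : ℕ :=
  if F = ∅ then 0 else Module.finrank ℝ (vectorSpan ℝ F) + 1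

namespace ConvexPolytope

/-- The faces of `P`, ordered by inclusion: the empty set and the sets of maximizers on `P` of
linear functionals. In particular `∅` and `P` itself are faces. -/
def Face (P : ConvexPolytope E) : Type _ := {F : Set E // IsExposed ℝ P.carrier F}

instance (P : ConvexPolytope E) : PartialOrder P.Face :=
  inferInstanceAs (PartialOrder {F : Set E // IsExposed ℝ P.carrier F})

theorem finite_exposed (P : ConvexPolytope E) : {F : Set E | IsExposed ℝ P.carrier F}.Finite := by
  obtain ⟨V, hV, hP⟩ := P.exists_finite
  have hcomp : IsCompact P.carrier := by rw [hP]; exact hV.isCompact_convexHull (𝕜 := ℝ)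
  have hconv : Convex ℝ P.carrier := by rw [hP]; exact convex_convexHull ℝ V
  refine Set.Finite.of_finite_image (f := fun F => F.extremePoints ℝ)
    (hV.finite_subsets.subset ?_) ?_
  · rintro _ ⟨F, hF, rfl⟩
    have h1 := (IsExposed.isExtreme hF).extremePoints_subset_extremePoints
    rw [hP] at h1
    exact h1.trans extremePoints_convexHull_subset
  · intro F hF G hG h
    have h1 := closure_convexHull_extremePoints (IsExposed.isCompact hF hcomp)
      (IsExposed.convex hF hconv)
    have h2 := closure_convexHull_extremePoints (IsExposed.isCompact hG hcomp)
      (IsExposed.convex hG hconv)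
    simp only at h
    rw [← h1, ← h2, h]

noncomputable instance (P : ConvexPolytope E) : Fintype P.Face := P.finite_exposed.fintype

/-- The polytope as a face of itself. -/
def topFace (P : ConvexPolytope E) : P.Face := ⟨P.carrier, IsExposed.refl P.carrier⟩

/-- The rank function of the face lattice: dimension plus one. -/
noncomputable def faceRank (P : ConvexPolytope E) (F : P.Face) : ℕ := dimSucc F.1

/-- `P` is nonempty and has dimension `d`. -/
def HasDim (P : ConvexPolytope E) (d : ℕ) : Prop := dimSucc P.carrier = d + 1

/-- The facets of `P`: the faces whose dimension is one less than that of `P`. -/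
def facets (P : ConvexPolytope E) : Set (Set E) :=
  {F | IsExposed ℝ P.carrier F ∧ dimSucc F + 1 = dimSucc P.carrier}

/-- The number `f_i` of `i`-dimensional faces (for `i = dim P` it counts `P` itself). -/
noncomputable def faceNumber (P : ConvexPolytope E) (i : ℕ) : ℕ :=
  Nat.card {F : P.Face // P.faceRank F = i + 1}

/-- The number `f_{ij}` of flags `F ⊂ G` with `dim F = i` and `dim G = j` (where `G = P` is
possible for `j = dim P`). -/
noncomputable def flagNumber (P : ConvexPolytope E) (i j : ℕ) : ℕ :=
  Nat.card {p : P.Face × P.Face //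
    p.1 < p.2 ∧ P.faceRank p.1 = i + 1 ∧ P.faceRank p.2 = j + 1}

/-- The entry `h_i` of the toric `h`-vector of a `d`-dimensional polytope:
the toric polynomial of its face lattice is `h_d + h_{d-1} X + ⋯ + h_0 X^d`. -/
noncomputable def toricH (P : ConvexPolytope E) (d i : ℕ) : ℤ :=
  (toricF P.faceRank P.topFace).coeff (d - i)

end ConvexPolytope

/-! ### Multiplexes -/

/-- The index `j`, replaced by `0` if `j < 0` and by `n` if `j > n`. -/
def clampIndex (n : ℕ) (j : ℤ) : Fin (n + 1) := ⟨min j.toNat n, by omega⟩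

/-- `conv {x_{i-d+1}, …, x_{i-1}, x_{i+1}, …, x_{i+d-1}}`, where `x_j = x_0` for `j < 0` and
`x_j = x_n` for `j > n`. -/
def multiplexFacet (d : ℕ) {n : ℕ} (x : Fin (n + 1) → E) (i : Fin (n + 1)) : Set E :=
  convexHull ℝ {y | ∃ j : ℤ, (i : ℤ) - d + 1 ≤ j ∧ j ≤ (i : ℤ) + d - 1 ∧ j ≠ (i : ℤ) ∧
    y = x (clampIndex n j)}

/-- `P` is a `d`-dimensional multiplex with ordered list of vertices `x_0, …, x_n`. -/
structure IsMultiplex (d n : ℕ) (P : ConvexPolytope E) (x : Fin (n + 1) → E) : Prop where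
  hasDim : P.HasDim d
  injective : Function.Injective x
  vertices : P.carrier.extremePoints ℝ = Set.range x
  facets : P.facets = Set.range (multiplexFacet d x)

end Polytopes

/-!
# Multiplexes are elementary

Number the vertices and the facets of the multiplex by `0, …, n`. As the vertices are in convex
position, the vertex `j` lies on the facet `i` iff `|i - j| < d` and `i ≠ j`, where `i = j` is
allowed for `i = 0` and `i = n` (`IsMultiplex.mem_facet_iff`). This incidence relation determines
the face lattice: a nonempty proper face of a polytope is the intersection of the facets containing
it (`ConvexPolytope.exists_facet_notMem`; by induction on the codimension, since rotating a
supporting hyperplane in both directions writes a face of codimension at least two as the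
intersection of two larger proper faces), and a face is the convex hull of its vertices. So the
vertex sets of the nonempty proper faces are the nonempty intersections of vertex sets of facets,
`IsFaceIndexSet`.

Dimensions are read off from chains of faces, because the dimension is strictly monotone on faces.
Let `a` and `b` be the least and the greatest vertex of a proper face `J`. If `b ≤ a + d`, every
subset of `J` that contains `a` and `b` is again a face, because facet `j` omits the vertex `j`. If
`b > a + d`, then `J` contains the quadrilateral `{a, a + 1, a + d, a + d + 1}`. Consequently

* the edges are the pairs with difference at most `d - 2` or equal to `d`, together with
  `{0, d - 1}` and `{n - d + 1, n}`, so that `f₁ = (d+1).choose 2 + (n - d) (d - 1)`;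
* for `d ≥ 3` the `2`-faces are triangles, except for the `n - d` quadrilaterals above, so that
  `f₀₂ - 3 f₂ = n - d`. For `d = 2` this holds as well, the only `2`-face being the `(n+1)`-gon.

With `f₀ = n + 1` this gives the linear relation between the flag numbers.

In the toric `h`-vector only faces of dimension at most `2` contribute to `h₁` and `h₂`, because the
degree of `g(F)` is at most `dim F / 2`. This gives `h₁ = f₀ - d` and
`h₂ = d.choose 2 - (d - 1) f₀ + f₁ + ∑ (f₀(F) - 3)`, the sum running over the proper `2`-faces, so
that `h₁ = h₂` is the same linear relation when `d ≥ 3`. For `n = d = 2` that sum is empty, but its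
value is still `n - d = 0`.
-/

/-! ### Faces of convex polytopes -/

section ConvexGeometry

variable {E : Type*} [NormedAddCommGroup E] [NormedSpace ℝ E]

theorem IsExposed.exists_le_and_eq {A F : Set E} (hF : IsExposed ℝ A F) (hne : F.Nonempty) :
    ∃ (l : StrongDual ℝ E) (c : ℝ), (∀ x ∈ A, l x ≤ c) ∧ F = {x ∈ A | l x = c} := by
  obtain ⟨l, hl⟩ := hF hne
  obtain ⟨p, hp⟩ := hne
  have hp' := hp
  rw [hl] at hp'
  refine ⟨l, l p, hp'.2, ?_⟩
  rw [hl]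
  ext x
  constructor
  · rintro ⟨hx, h⟩
    exact ⟨hx, le_antisymm (hp'.2 x hx) (h p hp'.1)⟩
  · rintro ⟨hx, h⟩
    exact ⟨hx, fun y hy => (hp'.2 y hy).trans h.ge⟩

theorem isExposed_setOf_eq {A : Set E} {l : StrongDual ℝ E} {c : ℝ} (h : ∀ x ∈ A, l x ≤ c) :
    IsExposed ℝ A {x ∈ A | l x = c} := by
  rintro ⟨p, hp, rfl⟩
  refine ⟨l, ?_⟩
  ext x
  constructor
  · rintro ⟨hx, h'⟩
    exact ⟨hx, fun y hy => (h y hy).trans h'.ge⟩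
  · rintro ⟨hx, h'⟩
    exact ⟨hx, le_antisymm (h x hx) (h' p hp)⟩

theorem dimSucc_of_nonempty {F : Set E} (hF : F.Nonempty) :
    dimSucc F = Module.finrank ℝ (vectorSpan ℝ F) + 1 := by
  rw [dimSucc, if_neg hF.ne_empty]

theorem dimSucc_empty : dimSucc (∅ : Set E) = 0 := by
  rw [dimSucc, if_pos rfl]

theorem dimSucc_eq_zero_iff {F : Set E} : dimSucc F = 0 ↔ F = ∅ := by
  unfold dimSucc
  split_ifs with h <;> simp [h]

theorem vectorSpan_convexHull (s : Set E) : vectorSpan ℝ (convexHull ℝ s) = vectorSpan ℝ s := by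
  rw [← direction_affineSpan, affineSpan_convexHull, direction_affineSpan]

theorem dimSucc_convexHull (s : Set E) : dimSucc (convexHull ℝ s) = dimSucc s := by
  simp only [dimSucc, convexHull_eq_empty]
  rw [vectorSpan_convexHull]

/-- Rotating the supporting hyperplane `l = c` of a polytope towards `m`, around the set where
`l = c` and `m = e`: in the pencil spanned by the two functionals, the last supporting hyperplane
contains a new point of the polytope. The point `w` serves when `m ≤ e` throughout. -/
theorem exists_rotated_support {S : Set E} (hS : S.Finite) {l m : StrongDual ℝ E} {c e : ℝ}
    (hl : ∀ x ∈ convexHull ℝ S, l x ≤ c)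
    (hm : ∀ x ∈ convexHull ℝ S, l x = c → m x = e)
    {w : E} (hw : w ∈ convexHull ℝ S) (hlw : l w ≠ c) (hmw : m w = e) :
    ∃ α β : ℝ, 0 ≤ α ∧ 0 < β ∧ (α = 0 → ∀ x ∈ convexHull ℝ S, m x ≤ e) ∧
      (∀ x ∈ convexHull ℝ S, α * l x + β * m x ≤ α * c + β * e) ∧
      ∃ u ∈ convexHull ℝ S, l u ≠ c ∧ α * l u + β * m u = α * c + β * e := by
  -- a linear inequality on the generators extends to the polytope
  have key : ∀ (k : StrongDual ℝ E) (b : ℝ), (∀ v ∈ S, k v ≤ b) →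
      ∀ x ∈ convexHull ℝ S, k x ≤ b := fun k b h =>
    convexHull_min h (convex_halfSpace_le k.toLinearMap.isLinear b)
  rcases (S ∩ {v | e < m v}).eq_empty_or_nonempty with hemp | hne
  · have hle : ∀ x ∈ convexHull ℝ S, m x ≤ e := by
      refine key m e fun v hv => not_lt.1 fun h => ?_
      exact (hemp ▸ (⟨hv, h⟩ : v ∈ S ∩ {v | e < m v}) : v ∈ (∅ : Set E))
    exact ⟨0, 1, le_rfl, one_pos, fun _ => hle, by simpa using hle, w, hw, hlw, by simp [hmw]⟩
  · obtain ⟨v, ⟨hvS, hv⟩, hmin⟩ := Set.exists_min_image _ (fun v => (c - l v) / (m v - e))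
      (hS.inter_of_left {v | e < m v}) hne
    simp only [Set.mem_ofPred_eq] at hv
    have hvP := subset_convexHull ℝ S hvS
    have hlv : l v ≠ c := fun h => hv.ne' (hm v hvP h)
    have hlv' : l v < c := lt_of_le_of_ne (hl v hvP) hlv
    refine ⟨1, (c - l v) / (m v - e), zero_le_one, div_pos (by linarith) (by linarith), by simp,
      ?_, v, hvP, hlv, ?_⟩
    · set t := (c - l v) / (m v - e) with ht
      have htpos : 0 < t := div_pos (by linarith) (by linarith)
      have := key (l + t • m) (c + t * e) fun u hu => ?_
      · simpa using this
      · have hlu := hl u (subset_convexHull ℝ S hu)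
        simp only [add_apply, smul_apply, smul_eq_mul]
        rcases le_or_gt (m u) e with hmu | hmu
        · have := mul_le_mul_of_nonneg_left hmu htpos.le
          linarith
        · have := hmin u ⟨hu, hmu⟩
          rw [le_div_iff₀ (by linarith)] at this
          linarith
    · have : m v - e ≠ 0 := by linarith
      field_simp
      ring

namespace ConvexPolytope

theorem convex_carrier (P : ConvexPolytope E) : Convex ℝ P.carrier := by
  obtain ⟨V, -, h⟩ := P.exists_finite
  rw [h]; exact convex_convexHull ℝ V

theorem isCompact_carrier (P : ConvexPolytope E) : IsCompact P.carrier := by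
  obtain ⟨V, hV, h⟩ := P.exists_finite
  rw [h]; exact hV.isCompact_convexHull (𝕜 := ℝ)

theorem le_topFace (P : ConvexPolytope E) (F : P.Face) : F ≤ P.topFace := F.2.subset

/-- The empty face. -/
def botFace (P : ConvexPolytope E) : P.Face := ⟨∅, isExposed_empty⟩

theorem botFace_le (P : ConvexPolytope E) (F : P.Face) : P.botFace ≤ F := Set.empty_subset F.1

theorem faceRank_eq_zero_iff (P : ConvexPolytope E) (F : P.Face) :
    P.faceRank F = 0 ↔ F = P.botFace :=
  dimSucc_eq_zero_iff.trans (Subtype.ext_iff (a1 := F) (a2 := P.botFace)).symm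

/-- A face is the convex hull of the vertices that it contains. -/
theorem convexHull_image_eq {P : ConvexPolytope E} {ι : Type*} [Finite ι] {x : ι → E}
    (hx : P.carrier.extremePoints ℝ = Set.range x) {F : Set E} (hF : IsExposed ℝ P.carrier F) :
    convexHull ℝ (x '' {j | x j ∈ F}) = F := by
  have hconv := hF.convex P.convex_carrier
  refine (convexHull_min (by rintro _ ⟨j, hj, rfl⟩; exact hj) hconv).antisymm ?_
  have h1 := closure_convexHull_extremePoints (hF.isCompact P.isCompact_carrier) hconv
  have h2 : F.extremePoints ℝ ⊆ x '' {j | x j ∈ F} := fun y hy => by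
    obtain ⟨j, rfl⟩ : y ∈ Set.range x := by
      rw [← hx]; exact hF.isExtreme.extremePoints_subset_extremePoints hy
    exact Set.mem_image_of_mem x (extremePoints_subset hy : x j ∈ F)
  have h3 : IsClosed (convexHull ℝ (x '' {j | x j ∈ F})) :=
    ((Set.toFinite (x '' {j | x j ∈ F})).isCompact_convexHull (𝕜 := ℝ)).isClosed
  calc F = closure (convexHull ℝ (F.extremePoints ℝ)) := h1.symm
    _ ⊆ _ := closure_minimal (convexHull_mono h2) h3

end ConvexPolytope

variable [FiniteDimensional ℝ E]

theorem subsingleton_of_dimSucc_eq_one {F : Set E} (h : dimSucc F = 1) : F.Subsingleton := by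
  have hne : F.Nonempty := by
    rw [Set.nonempty_iff_ne_empty]
    rintro rfl
    rw [dimSucc_empty] at h
    omega
  rw [dimSucc_of_nonempty hne] at h
  exact (vectorSpan_eq_bot_iff_subsingleton ℝ).1 (Submodule.finrank_eq_zero.1 (by omega))

theorem dimSucc_lt_of_ssubset {A F G : Set E} (hF : IsExposed ℝ A F) (hG : G ⊆ A)
    (h : F ⊂ G) : dimSucc F < dimSucc G := by
  obtain ⟨q, hqG, hqF⟩ := Set.exists_of_ssubset h
  rw [dimSucc_of_nonempty ⟨q, hqG⟩]
  rcases F.eq_empty_or_nonempty with rfl | hne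
  · rw [dimSucc_empty]; omega
  rw [dimSucc_of_nonempty hne]
  obtain ⟨l, c, hle, rfl⟩ := hF.exists_le_and_eq hne
  obtain ⟨p, hp⟩ := hne
  have hlt : vectorSpan ℝ {x ∈ A | l x = c} < vectorSpan ℝ G := by
    refine lt_of_le_of_ne (vectorSpan_mono ℝ h.subset) fun heq => hqF ⟨hG hqG, ?_⟩
    have h1 : vectorSpan ℝ {x ∈ A | l x = c} ≤ LinearMap.ker (l : E →ₗ[ℝ] ℝ) := by
      rw [vectorSpan, Submodule.span_le]
      rintro _ ⟨y, hy, z, hz, rfl⟩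
      simp [hy.2, hz.2]
    have h2 := h1 (heq ▸ vsub_mem_vectorSpan ℝ hqG (h.subset hp))
    simp only [LinearMap.mem_ker, vsub_eq_sub, map_sub] at h2
    have := hp.2
    simp only [ContinuousLinearMap.coe_coe] at h2
    linarith
  have := Submodule.finrank_lt_finrank_of_lt hlt
  omega

/-- A nonempty face of codimension at least two is the intersection of two larger proper faces. -/
theorem IsExposed.exists_inter_eq {S : Set E} (hS : S.Finite) {F : Set E}
    (hF : IsExposed ℝ (convexHull ℝ S) F) (hne : F.Nonempty)
    (hdim : dimSucc F + 1 < dimSucc (convexHull ℝ S)) :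
    ∃ G₁ G₂ : Set E, IsExposed ℝ (convexHull ℝ S) G₁ ∧ IsExposed ℝ (convexHull ℝ S) G₂ ∧
      F ⊂ G₁ ∧ F ⊂ G₂ ∧ G₁ ≠ convexHull ℝ S ∧ G₂ ≠ convexHull ℝ S ∧ F = G₁ ∩ G₂ := by
  have hFne : F ≠ convexHull ℝ S := fun h => by rw [h] at hdim; omega
  obtain ⟨w, hw, hwF⟩ := Set.exists_of_ssubset (hF.subset.ssubset_of_ne hFne)
  have hPne : (convexHull ℝ S).Nonempty := ⟨w, hw⟩
  rw [dimSucc_of_nonempty hne, dimSucc_of_nonempty hPne] at hdim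
  obtain ⟨l, c, hl, hFeq⟩ := hF.exists_le_and_eq hne
  obtain ⟨p, hp⟩ := hne
  have hpP : p ∈ convexHull ℝ S := hF.subset hp
  have hwc : l w ≠ c := fun h => hwF (hFeq ▸ ⟨hw, h⟩)
  -- a functional `m` constant on `F ∪ {w}` but not on the polytope
  have hnle : ¬ vectorSpan ℝ (convexHull ℝ S) ≤ vectorSpan ℝ (insert w F) := fun h => by
    have h1 := Submodule.finrank_mono h
    have h2 := finrank_vectorSpan_insert_le_set ℝ F w
    omega
  obtain ⟨v, hv, hvW⟩ := SetLike.not_le_iff_exists.1 hnle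
  obtain ⟨f, hfv, hf⟩ := Submodule.exists_le_ker_of_notMem hvW
  set m : StrongDual ℝ E := LinearMap.toContinuousLinearMap f with hm_def
  have hmf : ∀ y, m y = f y := fun y => rfl
  have hmF : ∀ x ∈ insert w F, m x = m p := fun x hx => by
    have := hf (vsub_mem_vectorSpan ℝ hx (Set.mem_insert_of_mem w hp))
    simp only [vsub_eq_sub, LinearMap.mem_ker, map_sub] at this
    rw [hmf, hmf]; linarith
  have hmP : ¬ ∀ x ∈ convexHull ℝ S, m x = m p := fun h => hfv <| by
    have : vectorSpan ℝ (convexHull ℝ S) ≤ LinearMap.ker f := by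
      rw [vectorSpan, Submodule.span_le]
      rintro _ ⟨y, hy, z, hz, rfl⟩
      have h1 := h y hy
      have h2 := h z hz
      rw [hmf] at h1 h2
      simp [h1, h2]
    exact this hv
  have hmw : m w = m p := hmF w (Set.mem_insert w F)
  have hlm : ∀ x ∈ convexHull ℝ S, l x = c → m x = m p := fun x hx h =>
    hmF x (Set.mem_insert_of_mem w (hFeq ▸ ⟨hx, h⟩))
  obtain ⟨α, β, hα, hβ, hα0, hsupp, u, hu, huc, hueq⟩ :=
    exists_rotated_support hS hl hlm hw hwc hmw
  obtain ⟨α', β', hα', hβ', hα0', hsupp', u', hu', huc', hueq'⟩ :=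
    exists_rotated_support hS (m := -m) (e := -m p) hl
      (fun x hx h => by simp [hlm x hx h]) hw hwc (by simp [hmw])
  have hpos : 0 < β' * α + β * α' := by
    rcases hα.eq_or_lt with h | h
    · rcases hα'.eq_or_lt with h' | h'
      · refine absurd (fun x hx => ?_) hmP
        have h1 := hα0 h.symm x hx
        have h2 := hα0' h'.symm x hx
        simp only [neg_apply] at h2
        linarith
      · positivity
    · positivity
  have hpc : l p = c := by rw [hFeq] at hp; exact hp.2
  have hprop : ∀ (α β : ℝ) (k : StrongDual ℝ E), (k = m ∨ k = -m) → 0 < β →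
      (∀ x ∈ convexHull ℝ S, α * l x + β * k x ≤ α * c + β * k p) →
      (∃ u ∈ convexHull ℝ S, l u ≠ c ∧ α * l u + β * k u = α * c + β * k p) →
      IsExposed ℝ (convexHull ℝ S)
        {x ∈ convexHull ℝ S | α * l x + β * k x = α * c + β * k p} ∧
      F ⊂ {x ∈ convexHull ℝ S | α * l x + β * k x = α * c + β * k p} ∧
      {x ∈ convexHull ℝ S | α * l x + β * k x = α * c + β * k p} ≠ convexHull ℝ S := by
    intro α β k hk hβ hsupp ⟨u, hu, huc, hueq⟩
    have hkF : ∀ x ∈ insert w F, k x = k p := fun x hx => by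
      rcases hk with rfl | rfl
      · exact hmF x hx
      · simp [hmF x hx]
    refine ⟨?_, ⟨fun x hx => ?_, fun hsub => ?_⟩, fun heq => ?_⟩
    · have := isExposed_setOf_eq (l := α • l + β • k) (A := convexHull ℝ S)
        (c := α * c + β * k p) (by simpa using hsupp)
      simpa using this
    · have hx' := hx
      rw [hFeq] at hx'
      exact ⟨hx'.1, by rw [hx'.2, hkF x (Set.mem_insert_of_mem w hx)]⟩
    · have := hsub ⟨hu, hueq⟩
      rw [hFeq] at this
      exact huc this.2
    · have hw' : w ∈ {x ∈ convexHull ℝ S | α * l x + β * k x = α * c + β * k p} := by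
        rw [heq]; exact hw
      have h1 := hw'.2
      rw [hkF w (Set.mem_insert w F)] at h1
      have hα : α = 0 := by
        have : α * (l w - c) = 0 := by linarith
        exact (mul_eq_zero.1 this).resolve_right (sub_ne_zero.2 hwc)
      refine hmP fun x hx => ?_
      have hx' : x ∈ {x ∈ convexHull ℝ S | α * l x + β * k x = α * c + β * k p} := by
        rw [heq]; exact hx
      have h2 := hx'.2
      rw [hα] at h2
      have h3 : k x = k p := by
        have : β * (k x - k p) = 0 := by linarith
        exact sub_eq_zero.1 ((mul_eq_zero.1 this).resolve_left hβ.ne')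
      rcases hk with rfl | rfl
      · exact h3
      · simpa using h3
  obtain ⟨a1, a2, a3⟩ := hprop α β m (Or.inl rfl) hβ hsupp ⟨u, hu, huc, hueq⟩
  obtain ⟨b1, b2, b3⟩ := hprop α' β' (-m) (Or.inr rfl) hβ' (by simpa using hsupp')
    ⟨u', hu', huc', by simpa using hueq'⟩
  refine ⟨_, _, a1, b1, a2, b2, a3, b3, (Set.subset_inter a2.1 b2.1).antisymm ?_⟩
  rintro x ⟨⟨hx, h1⟩, ⟨-, h2⟩⟩
  rw [hFeq]
  refine ⟨hx, ?_⟩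
  simp only [neg_apply] at h2
  -- the combination of both equations in which `m` cancels
  have : (β' * α + β * α') * (l x - c) = 0 := by linear_combination β' * h1 + β * h2
  exact sub_eq_zero.1 ((mul_eq_zero.1 this).resolve_left hpos.ne')

namespace ConvexPolytope

/-- A nonempty proper face is the intersection of the facets containing it. -/
theorem exists_facet_notMem (P : ConvexPolytope E) {F : Set E} (hF : IsExposed ℝ P.carrier F)
    (hne : F.Nonempty) (hFP : F ≠ P.carrier) {y : E} (hy : y ∉ F) :
    ∃ G ∈ P.facets, F ⊆ G ∧ y ∉ G := by
  induction hk : dimSucc P.carrier - dimSucc F using Nat.strong_induction_on generalizing F with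
  | _ k ih =>
    have hlt := dimSucc_lt_of_ssubset hF subset_rfl (hF.subset.ssubset_of_ne hFP)
    by_cases h : dimSucc F + 1 = dimSucc P.carrier
    · exact ⟨F, ⟨hF, h⟩, subset_rfl, hy⟩
    · obtain ⟨V, hV, hP⟩ := P.exists_finite
      obtain ⟨G₁, G₂, e₁, e₂, s₁, s₂, n₁, n₂, hi⟩ :=
        IsExposed.exists_inter_eq hV (hP ▸ hF) hne (hP ▸ by omega)
      rw [← hP] at e₁ e₂ n₁ n₂
      have step : ∀ G, IsExposed ℝ P.carrier G → F ⊂ G → G ≠ P.carrier → y ∉ G →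
          ∃ G ∈ P.facets, F ⊆ G ∧ y ∉ G := fun G e s n hyG => by
        have h1 := dimSucc_lt_of_ssubset hF e.subset s
        have h2 := dimSucc_lt_of_ssubset e subset_rfl (e.subset.ssubset_of_ne n)
        obtain ⟨K, hK, hGK, hyK⟩ := ih _ (by omega) e (hne.mono s.1) n hyG rfl
        exact ⟨K, hK, s.1.trans hGK, hyK⟩
      rw [hi, Set.mem_inter_iff, not_and_or] at hy
      rcases hy with hy | hy
      · exact step G₁ e₁ s₁ n₁ hy
      · exact step G₂ e₂ s₂ n₂ hy

theorem faceRank_strictMono (P : ConvexPolytope E) : StrictMono P.faceRank := fun F G h =>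
  dimSucc_lt_of_ssubset F.2 G.2.subset h

end ConvexPolytope

end ConvexGeometry

/-! ### The toric `h`-vector in low degrees -/

section ToricLowDegree

theorem toricTruncation_natDegree_le (d : ℕ) (f : ℤ[X]) : (toricTruncation d f).natDegree ≤ d / 2 :=
  natDegree_sum_le_of_forall_le _ _ fun i hi =>
    (natDegree_C_mul_X_pow_le _ i).trans (by simp only [Finset.mem_range] at hi; omega)

variable {L : Type*} [PartialOrder L] [Fintype L]

open Classical in
theorem toricG_of_ne_zero (ρ : L → ℕ) {t : L} (ht : ρ t ≠ 0) :
    toricG ρ t = toricTruncation (ρ t - 1) (toricF ρ t) := by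
  rw [toricG, if_neg ht, toricF]

theorem toricG_natDegree_le (ρ : L → ℕ) (t : L) : (toricG ρ t).natDegree ≤ (ρ t - 1) / 2 := by
  by_cases h : ρ t = 0
  · rw [toricG, if_pos h]; simp
  · rw [toricG_of_ne_zero ρ h]; exact toricTruncation_natDegree_le _ _

open Classical in
theorem coeff_toricF (ρ : L → ℕ) (t : L) (k : ℕ) :
    (toricF ρ t).coeff k =
      ∑ s ∈ Finset.univ.filter (· < t), (toricG ρ s * (X - 1) ^ (ρ t - ρ s - 1)).coeff k := by
  rw [toricF, finsetSum_coeff, ← Finset.sum_subtype_eq_sum_filter]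
  simp [Finset.subtype_univ]

theorem coeff_X_sub_one_pow_self (n : ℕ) : ((X - 1 : ℤ[X]) ^ n).coeff n = 1 := by
  have h : (X - 1 : ℤ[X]) = X - C 1 := by simp
  have := (monic_X_sub_C (1 : ℤ)).pow n
  rw [h]
  have h2 := this.coeff_natDegree
  rwa [(monic_X_sub_C (1 : ℤ)).natDegree_pow, natDegree_X_sub_C, mul_one] at h2

theorem natDegree_X_sub_one_pow (n : ℕ) : ((X - 1 : ℤ[X]) ^ n).natDegree = n := by
  have h : (X - 1 : ℤ[X]) = X - C 1 := by simp
  rw [h, (monic_X_sub_C (1 : ℤ)).natDegree_pow, natDegree_X_sub_C, mul_one]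

theorem coeff_X_sub_one_pow_succ (n : ℕ) : ((X - 1 : ℤ[X]) ^ (n + 1)).coeff n = -(n + 1 : ℤ) := by
  have := coeff_X_add_C_pow (-1 : ℤ) (n + 1) n
  rw [C_neg, C_1, ← sub_eq_add_neg] at this
  rw [this]; simp

theorem coeff_X_sub_one_pow_succ_succ (n : ℕ) :
    ((X - 1 : ℤ[X]) ^ (n + 2)).coeff n = ((n + 2).choose 2 : ℤ) := by
  have := coeff_X_add_C_pow (-1 : ℤ) (n + 2) n
  rw [C_neg, C_1, ← sub_eq_add_neg] at this
  rw [this, Nat.choose_symm_add]; simp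

theorem coeff_mul_X_sub_one_pow_eq_zero {g : ℤ[X]} {m k : ℕ} (h : g.natDegree + m < k) :
    (g * (X - 1) ^ m).coeff k = 0 :=
  coeff_eq_zero_of_natDegree_lt <| natDegree_mul_le.trans_lt (by rwa [natDegree_X_sub_one_pow])

variable {ρ : L → ℕ} {b : L}

open Classical in
/-- The elements of rank `r` below `t`. -/
noncomputable def elementsBelow (ρ : L → ℕ) (t : L) (r : ℕ) : Finset L :=
  Finset.univ.filter fun s => s < t ∧ ρ s = r

theorem mem_elementsBelow {t s : L} {r : ℕ} : s ∈ elementsBelow ρ t r ↔ s < t ∧ ρ s = r := by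
  simp [elementsBelow]

/-- A ranked poset with a least element, the only one of rank `0`. -/
structure IsBottomRanked (ρ : L → ℕ) (b : L) : Prop where
  strictMono : StrictMono ρ
  bot_le : ∀ s, b ≤ s
  rank_eq_zero_iff : ∀ s, ρ s = 0 ↔ s = b

open Classical in
/-- If only elements of rank less than `m` contribute to the coefficient of `X^k`, it is the sum
of their contributions, rank by rank. -/
theorem coeff_toricF_eq_sum_range (t : L) (k m : ℕ)
    (h : ∀ s < t, m ≤ ρ s → (toricG ρ s * (X - 1) ^ (ρ t - ρ s - 1)).coeff k = 0) :
    (toricF ρ t).coeff k = ∑ r ∈ Finset.range m, ∑ s ∈ elementsBelow ρ t r,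
      (toricG ρ s * (X - 1) ^ (ρ t - r - 1)).coeff k := by
  rw [coeff_toricF, ← Finset.sum_filter_add_sum_filter_not _ (fun s => ρ s < m)]
  rw [Finset.sum_eq_zero (s := {s ∈ Finset.univ.filter (· < t) | ¬ρ s < m}), add_zero]
  · rw [← Finset.sum_fiberwise_of_maps_to (t := Finset.range m) (g := ρ) (by simp)]
    refine Finset.sum_congr rfl fun r hr => ?_
    refine Finset.sum_congr ?_ fun s hs => ?_
    · ext s
      simp only [elementsBelow, Finset.mem_filter, Finset.mem_univ, true_and]
      simp only [Finset.mem_range] at hr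
      grind
    · rw [(mem_elementsBelow.1 hs).2]
  · intro s hs
    simp only [Finset.mem_filter, Finset.mem_univ, true_and, not_lt] at hs
    exact h s hs.1 hs.2

namespace IsBottomRanked

theorem elementsBelow_zero (hρ : IsBottomRanked ρ b) {t : L} (ht : ρ t ≠ 0) :
    elementsBelow ρ t 0 = {b} := by
  ext s
  rw [mem_elementsBelow, Finset.mem_singleton, hρ.rank_eq_zero_iff]
  refine ⟨fun h => h.2, ?_⟩
  rintro rfl
  exact ⟨(hρ.bot_le t).lt_of_ne fun h => ht ((hρ.rank_eq_zero_iff t).2 h.symm), rfl⟩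

theorem toricG_bot (hρ : IsBottomRanked ρ b) : toricG ρ b = 1 := by
  rw [toricG, if_pos ((hρ.rank_eq_zero_iff b).2 rfl)]

/-- The entry `h₀` of the toric `h`-vector. -/
theorem coeff_toricF_top (hρ : IsBottomRanked ρ b) {t : L} {d : ℕ} (ht : ρ t = d + 1) :
    (toricF ρ t).coeff d = 1 := by
  rw [coeff_toricF_eq_sum_range t d 1]
  · simp only [Finset.sum_range_one, hρ.elementsBelow_zero (t := t) (by omega),
      Finset.sum_singleton, hρ.toricG_bot, ht, one_mul]
    exact coeff_X_sub_one_pow_self d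
  · intro s hs h1
    have h2 := hρ.strictMono hs
    have h3 := toricG_natDegree_le ρ s
    exact coeff_mul_X_sub_one_pow_eq_zero (by omega)

theorem toricG_eq_one (hρ : IsBottomRanked ρ b) {t : L} (ht : ρ t ≤ 2) : toricG ρ t = 1 := by
  rcases Nat.eq_zero_or_pos (ρ t) with h | h
  · rw [(hρ.rank_eq_zero_iff t).1 h, hρ.toricG_bot]
  · rw [toricG_of_ne_zero ρ h.ne', toricTruncation]
    have h1 : (ρ t - 1) / 2 + 1 = 1 := by omega
    have h2 := hρ.coeff_toricF_top (t := t) (d := ρ t - 1) (by omega)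
    simp [h1, h2]

/-- The entry `h₁` of the toric `h`-vector. -/
theorem coeff_toricF_succ (hρ : IsBottomRanked ρ b) {t : L} {d : ℕ} (ht : ρ t = d + 2) :
    (toricF ρ t).coeff d = (elementsBelow ρ t 1).card - (d + 1 : ℤ) := by
  rw [coeff_toricF_eq_sum_range t d 2]
  · simp only [Finset.sum_range_succ, Finset.sum_range_zero, zero_add,
      hρ.elementsBelow_zero (t := t) (by omega),
      Finset.sum_singleton, hρ.toricG_bot, ht, one_mul]
    rw [show d + 2 - 0 - 1 = d + 1 by omega, show d + 2 - 1 - 1 = d by omega,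
      coeff_X_sub_one_pow_succ, Finset.sum_congr rfl (g := fun _ => (1 : ℤ)) ?_]
    · simp; ring
    · intro s hs
      rw [hρ.toricG_eq_one (by have := (mem_elementsBelow.1 hs).2; omega), one_mul,
        coeff_X_sub_one_pow_self]
  · intro s hs h1
    have h2 := hρ.strictMono hs
    have h3 := toricG_natDegree_le ρ s
    exact coeff_mul_X_sub_one_pow_eq_zero (by omega)

/-- The `g`-polynomial of a polygon with `v` vertices is `1 + (v - 3) X`. -/
theorem toricG_of_rank_three (hρ : IsBottomRanked ρ b) {t : L} (ht : ρ t = 3) :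
    toricG ρ t = 1 + C ((elementsBelow ρ t 1).card - 3 : ℤ) * X := by
  have h1 := hρ.coeff_toricF_top ht
  have h2 := hρ.coeff_toricF_succ ht
  rw [toricG_of_ne_zero ρ (by omega), toricTruncation, ht]
  simp only [show (3 - 1) / 2 + 1 = 2 by norm_num, Finset.sum_range_succ, Finset.sum_range_zero]
  norm_num [h1, h2]
  ring

/-- The entry `h₂` of the toric `h`-vector. -/
theorem coeff_toricF_succ_succ (hρ : IsBottomRanked ρ b) {t : L} {d : ℕ} (ht : ρ t = d + 3) :
    (toricF ρ t).coeff d = ((d + 2).choose 2 : ℤ) - (d + 1) * (elementsBelow ρ t 1).card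
      + (elementsBelow ρ t 2).card
      + ∑ s ∈ elementsBelow ρ t 3, ((elementsBelow ρ s 1).card - 3 : ℤ) := by
  rw [coeff_toricF_eq_sum_range t d 4]
  · simp only [Finset.sum_range_succ, Finset.sum_range_zero, zero_add,
      hρ.elementsBelow_zero (t := t) (by omega),
      Finset.sum_singleton, hρ.toricG_bot, ht, one_mul]
    rw [show d + 3 - 0 - 1 = d + 2 by omega, show d + 3 - 1 - 1 = d + 1 by omega,
      show d + 3 - 2 - 1 = d by omega, show d + 3 - 3 - 1 = d - 1 by omega,
      coeff_X_sub_one_pow_succ_succ,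
      Finset.sum_congr (s₁ := elementsBelow ρ t 1) rfl (g := fun _ => -(d + 1 : ℤ)) ?_,
      Finset.sum_congr (s₁ := elementsBelow ρ t 2) rfl (g := fun _ => (1 : ℤ)) ?_,
      Finset.sum_congr (s₁ := elementsBelow ρ t 3) rfl
        (g := fun s => ((elementsBelow ρ s 1).card - 3 : ℤ)) ?_]
    · simp; ring
    · intro s hs
      obtain ⟨h1, h2⟩ := mem_elementsBelow.1 hs
      have h3 := hρ.strictMono h1
      obtain ⟨e, rfl⟩ : ∃ e, d = e + 1 := ⟨d - 1, by omega⟩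
      rw [hρ.toricG_of_rank_three h2, Nat.add_sub_cancel, add_mul, one_mul, coeff_add,
        coeff_eq_zero_of_natDegree_lt (by rw [natDegree_X_sub_one_pow]; omega), zero_add,
        mul_assoc, coeff_C_mul, coeff_X_mul, coeff_X_sub_one_pow_self, mul_one]
    · intro s hs
      rw [hρ.toricG_eq_one (by have := (mem_elementsBelow.1 hs).2; omega), one_mul,
        coeff_X_sub_one_pow_self]
    · intro s hs
      rw [hρ.toricG_eq_one (by have := (mem_elementsBelow.1 hs).2; omega), one_mul,
        coeff_X_sub_one_pow_succ]
  · intro s hs h1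
    have h2 := hρ.strictMono hs
    have h3 := toricG_natDegree_le ρ s
    exact coeff_mul_X_sub_one_pow_eq_zero (by omega)

end IsBottomRanked

end ToricLowDegree

/-! ### The vertex sets of the faces of a multiplex -/

section MultiplexCombinatorics

/-- Incidence of the vertex `j` and the facet `i` of a `d`-dimensional multiplex with vertices
`0, …, n`: `|i - j| < d`, and `j ≠ i` unless `i` is `0` or `n`. The relation is symmetric. -/
def MultiplexIncident (d n i j : ℕ) : Prop :=
  i < j + d ∧ j < i + d ∧ (i = j → i = 0 ∨ i = n)

/-- The vertex sets of the proper faces of a `d`-dimensional multiplex with vertices `0, …, n`,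
described combinatorially as the intersections of nonempty families of vertex sets of facets. -/
structure IsFaceIndexSet (d n : ℕ) (J : Finset ℕ) : Prop where
  le : ∀ j ∈ J, j ≤ n
  exists_incident : ∃ i ≤ n, ∀ k ∈ J, MultiplexIncident d n i k
  closed : ∀ j ≤ n, j ∉ J → ∃ i ≤ n, (∀ k ∈ J, MultiplexIncident d n i k) ∧
    ¬ MultiplexIncident d n i j

variable {d n a b k : ℕ} {J K : Finset ℕ}

theorem isFaceIndexSet_pair_of_le (hd : 2 ≤ d) (hn : d ≤ n) (hab : a ≤ b) (hb : b ≤ n)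
    (h : b + 2 ≤ a + d) : IsFaceIndexSet d n {a, b} := by
  constructor
  · simp; omega
  · refine ⟨b - (d - 1), by omega, ?_⟩
    simp only [Finset.mem_insert, Finset.mem_singleton, MultiplexIncident]
    omega
  · intro j hj hjJ
    simp only [Finset.mem_insert, Finset.mem_singleton, MultiplexIncident, not_or, forall_eq_or_imp,
      forall_eq] at hjJ ⊢
    by_cases h1 : a + d ≤ j
    · exact ⟨b - (d - 1), by omega, by omega, by omega⟩
    by_cases h2 : j + d ≤ b ∨ j = 0
    · exact ⟨min n (a + d - 1), by omega, by omega, by omega⟩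
    by_cases h3 : j = n
    · exact ⟨b - (d - 1), by omega, by omega, by omega⟩
    · exact ⟨j, hj, by omega, by omega⟩

theorem isFaceIndexSet_singleton (hd : 2 ≤ d) (hn : d ≤ n) (ha : a ≤ n) :
    IsFaceIndexSet d n {a} := by
  simpa using isFaceIndexSet_pair_of_le hd hn le_rfl ha (show a + 2 ≤ a + d by omega)

/-- The indices `a, …, a + k` and `a + d, …, a + d + k`, as far as they do not exceed `n`. For
`k = 0` this is an edge of the multiplex, and for `k = d - 2` it is a facet. -/
def multiplexWindow (d n a k : ℕ) : Finset ℕ :=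
  Finset.Icc a (a + k) ∪ Finset.Icc (a + d) (min n (a + d + k))

theorem mem_multiplexWindow {j : ℕ} : j ∈ multiplexWindow d n a k ↔
    a ≤ j ∧ j ≤ a + k ∨ a + d ≤ j ∧ j ≤ n ∧ j ≤ a + d + k := by
  simp [multiplexWindow]

/-- `multiplexWindow d n a k` is the intersection of the facets `a + k + 1, …, a + d - 1`. -/
theorem isFaceIndexSet_window (hk : k + 2 ≤ d) (ha : a + d ≤ n) :
    IsFaceIndexSet d n (multiplexWindow d n a k) := by
  constructor
  · simp only [mem_multiplexWindow]; omega
  · refine ⟨a + k + 1, by omega, ?_⟩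
    simp only [mem_multiplexWindow, MultiplexIncident]
    omega
  · intro j hj hjJ
    simp only [mem_multiplexWindow, MultiplexIncident] at hjJ ⊢
    by_cases h1 : j < a
    · exact ⟨a + d - 1, by omega, by omega, by omega⟩
    by_cases h2 : j < a + d
    · exact ⟨j, by omega, by omega, by omega⟩
    · exact ⟨a + k + 1, by omega, by omega, by omega⟩

theorem multiplexWindow_ssubset_succ (hk : k + 1 < d) (ha : a + d ≤ n) :
    multiplexWindow d n a k ⊂ multiplexWindow d n a (k + 1) := by
  rw [Finset.ssubset_iff_of_subset fun j => by simp only [mem_multiplexWindow]; omega]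
  refine ⟨a + k + 1, ?_, ?_⟩ <;> rw [mem_multiplexWindow] <;> omega

theorem multiplexWindow_zero (ha : a + d ≤ n) : multiplexWindow d n a 0 = {a, a + d} := by
  ext j
  simp only [mem_multiplexWindow, Finset.mem_insert, Finset.mem_singleton]
  omega

theorem multiplexWindow_one (ha : a + d < n) :
    multiplexWindow d n a 1 = {a, a + 1, a + d, a + d + 1} := by
  ext j
  simp only [mem_multiplexWindow, Finset.mem_insert, Finset.mem_singleton]
  omega

theorem card_multiplexWindow_one (hd : 3 ≤ d) (ha : a + d < n) :
    (multiplexWindow d n a 1).card = 4 := by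
  rw [multiplexWindow_one ha, Finset.card_insert_of_notMem, Finset.card_insert_of_notMem,
    Finset.card_pair (by omega)] <;> simp only [Finset.mem_insert, Finset.mem_singleton] <;> omega

theorem IsFaceIndexSet.mem_of_forall (hJ : IsFaceIndexSet d n J) {j : ℕ} (hj : j ≤ n)
    (h : ∀ i ≤ n, (∀ k ∈ J, MultiplexIncident d n i k) → MultiplexIncident d n i j) : j ∈ J := by
  by_contra hjJ
  obtain ⟨i, hi, h1, h2⟩ := hJ.closed j hj hjJ
  exact h2 (h i hi h1)

theorem IsFaceIndexSet.window_subset (hJ : IsFaceIndexSet d n J) (ha : a ∈ J) (hb : b ∈ J)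
    (hab : a + d < b) : multiplexWindow d n a 1 ⊆ J := by
  have hbn := hJ.le b hb
  rw [multiplexWindow_one (by omega)]
  intro j hj
  simp only [Finset.mem_insert, Finset.mem_singleton] at hj
  by_cases hja : j = a
  · exact hja ▸ ha
  by_cases hjb : j = b
  · exact hjb ▸ hb
  refine hJ.mem_of_forall (by omega) fun i hi h => ?_
  have h1 := h a ha
  have h2 := h b hb
  simp only [MultiplexIncident] at h1 h2 ⊢
  omega

theorem IsFaceIndexSet.eq_zero_or_eq_of_diameter (hJ : IsFaceIndexSet d n J)
    (ha : a ∈ J) (hb : b ∈ J) (hmin : ∀ j ∈ J, a ≤ j)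
    (hab : b + 1 = a + d) : a = 0 ∨ b = n := by
  by_contra! hcon
  have hbn := hJ.le b hb
  have : a - 1 ∈ J := hJ.mem_of_forall (by omega) fun i hi h => by
    have h1 := h a ha
    have h2 := h b hb
    simp only [MultiplexIncident] at h1 h2 ⊢
    omega
  have := hmin _ this
  omega

/-- Faces of small diameter are simplices, at least as far as subsets containing the extreme
vertices `a` and `b` are concerned: a vertex `j` strictly between them is cut off by facet `j`. -/
theorem IsFaceIndexSet.of_subset (hJ : IsFaceIndexSet d n J) (ha : a ∈ K) (hb : b ∈ K)
    (hmin : ∀ j ∈ J, a ≤ j) (hmax : ∀ j ∈ J, j ≤ b) (hab : b ≤ a + d) (hKJ : K ⊆ J) :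
    IsFaceIndexSet d n K := by
  refine ⟨fun j hj => hJ.le j (hKJ hj), ?_, fun j hj hjK => ?_⟩
  · obtain ⟨i, hi, h⟩ := hJ.exists_incident
    exact ⟨i, hi, fun k hk => h k (hKJ hk)⟩
  · by_cases hjJ : j ∈ J
    · have h1 := hmin j hjJ
      have h2 := hmax j hjJ
      have h3 : j ≠ a := fun h => hjK (h ▸ ha)
      have h4 : j ≠ b := fun h => hjK (h ▸ hb)
      have hbn := hJ.le b (hKJ hb)
      refine ⟨j, hj, fun k hk => ?_, ?_⟩
      · have h5 := hmin k (hKJ hk)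
        have h6 := hmax k (hKJ hk)
        have h7 : j ≠ k := fun h => hjK (h ▸ hk)
        simp only [MultiplexIncident]
        omega
      · rintro ⟨-, -, h⟩
        have := h rfl
        omega
    · obtain ⟨i, hi, h1, h2⟩ := hJ.closed j hj hjJ
      exact ⟨i, hi, fun k hk => h1 k (hKJ hk), h2⟩

/-- The edges of a multiplex. -/
theorem isFaceIndexSet_pair_iff (hd : 2 ≤ d) (hn : d ≤ n) (hab : a < b) (hb : b ≤ n) :
    IsFaceIndexSet d n {a, b} ↔
      b + 2 ≤ a + d ∨ b = a + d ∨ b + 1 = a + d ∧ (a = 0 ∨ b = n) := by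
  constructor
  · intro h
    have ha' : a ∈ ({a, b} : Finset ℕ) := by simp
    have hb' : b ∈ ({a, b} : Finset ℕ) := by simp
    have h1 : b + 1 = a + d → a = 0 ∨ b = n := fun h1 =>
      h.eq_zero_or_eq_of_diameter ha' hb' (by simp; omega) h1
    have h2 : ¬ a + d < b := fun h2 => by
      have := h.window_subset ha' hb' h2 (by rw [mem_multiplexWindow]; omega : a + d ∈ _)
      simp at this
      omega
    omega
  · rintro (h | rfl | ⟨h, h'⟩)
    · exact isFaceIndexSet_pair_of_le hd hn hab.le hb h
    · rw [← multiplexWindow_zero hb]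
      exact isFaceIndexSet_window (by omega) hb
    · -- such a pair spans a simplex facet at one of the two ends
      have hI : IsFaceIndexSet d n (Finset.Icc a b) := by
        constructor
        · simp only [Finset.mem_Icc]; omega
        · refine ⟨if a = 0 then 0 else n, by split_ifs <;> omega, ?_⟩
          simp only [Finset.mem_Icc, MultiplexIncident]
          split_ifs <;> omega
        · intro j hj hjJ
          rw [Finset.mem_Icc] at hjJ
          refine ⟨if a = 0 then 0 else n, by split_ifs <;> omega, fun k hk => ?_, ?_⟩
          · rw [Finset.mem_Icc] at hk
            unfold MultiplexIncident
            split_ifs <;> omega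
          · unfold MultiplexIncident
            split_ifs <;> omega
      refine hI.of_subset (a := a) (b := b) (by simp) (by simp) ?_ ?_ (by omega) ?_
      · simp only [Finset.mem_Icc]; omega
      · simp only [Finset.mem_Icc]; omega
      · intro j
        simp only [Finset.mem_Icc, Finset.mem_insert, Finset.mem_singleton]; omega

theorem exists_min_max_mem (hJ : J.Nonempty) :
    ∃ a ∈ J, ∃ b ∈ J, (∀ j ∈ J, a ≤ j) ∧ ∀ j ∈ J, j ≤ b :=
  ⟨J.min' hJ, J.min'_mem hJ, J.max' hJ, J.max'_mem hJ, fun j => J.min'_le j, fun j => J.le_max' j⟩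

theorem IsFaceIndexSet.exists_pair (hd : 2 ≤ d) (hJ : IsFaceIndexSet d n J)
    (hcard : 2 ≤ J.card) : ∃ a b, a < b ∧ {a, b} ⊆ J ∧ IsFaceIndexSet d n {a, b} := by
  obtain ⟨a, ha, b, hb, hmin, hmax⟩ := exists_min_max_mem (J := J) (Finset.card_pos.1 (by omega))
  rcases le_or_gt b (a + d) with h | h
  · have hab : a < b := by
      obtain ⟨c, hc, e, he, hce⟩ := Finset.one_lt_card.1 (show 1 < J.card by omega)
      have := hmin c hc
      have := hmin e he
      have := hmax c hc
      have := hmax e he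
      omega
    have hsub : {a, b} ⊆ J := by
      simp [Finset.insert_subset_iff, ha, hb]
    exact ⟨a, b, hab, hsub, hJ.of_subset (by simp) (by simp) hmin hmax h hsub⟩
  · have hbn := hJ.le b hb
    have h0 := multiplexWindow_zero (d := d) (n := n) (a := a) (by omega)
    refine ⟨a, a + d, by omega, ?_, ?_⟩
    · rw [← h0]
      exact (multiplexWindow_ssubset_succ (by omega) (by omega)).subset.trans
        (hJ.window_subset ha hb h)
    · rw [← h0]
      exact isFaceIndexSet_window (by omega) (by omega)

/-- A face with at least four vertices, other than one of the quadrilaterals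
`a, a + 1, a + d, a + d + 1`, is at least three-dimensional. -/
theorem IsFaceIndexSet.exists_chain (hd : 3 ≤ d) (hJ : IsFaceIndexSet d n J)
    (hcard : 4 ≤ J.card) : (∃ a, a + d < n ∧ J = multiplexWindow d n a 1) ∨
      ∃ a b K, a < b ∧ IsFaceIndexSet d n {a, b} ∧ IsFaceIndexSet d n K ∧ {a, b} ⊂ K ∧ K ⊂ J := by
  obtain ⟨a, ha, b, hb, hmin, hmax⟩ := exists_min_max_mem (J := J) (Finset.card_pos.1 (by omega))
  have hbn := hJ.le b hb
  rcases le_or_gt b (a + d) with h | h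
  · right
    have hsub : {a, b} ⊆ J := by
      simp [Finset.insert_subset_iff, ha, hb]
    obtain ⟨c, hcJ, hc⟩ : ∃ c ∈ J, c ∉ ({a, b} : Finset ℕ) :=
      Finset.exists_mem_notMem_of_card_lt_card
        (by have := Finset.card_le_two (a := a) (b := b); omega)
    have h3 : (insert c {a, b} : Finset ℕ).card ≤ 3 := Finset.card_le_three
    have hsub' : insert c {a, b} ⊆ J := Finset.insert_subset hcJ hsub
    have hcmin := hmin c hcJ
    have hcmax := hmax c hcJ
    simp only [Finset.mem_insert, Finset.mem_singleton, not_or] at hc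
    refine ⟨a, b, insert c {a, b}, by omega, hJ.of_subset (by simp) (by simp) hmin hmax h hsub,
      hJ.of_subset (by simp) (by simp) hmin hmax h hsub', Finset.ssubset_insert (by simp [hc]),
      hsub'.ssubset_of_ne ?_⟩
    rintro heq
    rw [heq] at h3
    omega
  · have hsub := hJ.window_subset ha hb h
    by_cases heq : J = multiplexWindow d n a 1
    · exact Or.inl ⟨a, by omega, heq⟩
    · refine Or.inr ⟨a, a + d, multiplexWindow d n a 1, by omega, ?_,
        isFaceIndexSet_window (by omega) (by omega), ?_, hsub.ssubset_of_ne (Ne.symm heq)⟩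
      · rw [← multiplexWindow_zero (d := d) (n := n) (a := a) (by omega)]
        exact isFaceIndexSet_window (by omega) (by omega)
      · rw [← multiplexWindow_zero (d := d) (n := n) (a := a) (by omega)]
        exact multiplexWindow_ssubset_succ (by omega) (by omega)

/-- The pairs `a < b` that are edges of the multiplex. -/
def multiplexEdges (d n : ℕ) : Finset (ℕ × ℕ) :=
  (Finset.range (n + 1) ×ˢ Finset.range (n + 1)).filter fun p => p.1 < p.2 ∧
    (p.2 + 2 ≤ p.1 + d ∨ p.2 = p.1 + d ∨ p.2 + 1 = p.1 + d ∧ (p.1 = 0 ∨ p.2 = n))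

theorem sum_range_min (m k : ℕ) :
    ∑ b ∈ Finset.range (m + k + 1), min b m = (m + 1).choose 2 + k * m := by
  induction k with
  | zero =>
    rw [Finset.sum_congr rfl (g := fun b => b) fun b hb => by
      simp only [Finset.mem_range] at hb; omega]
    rw [Finset.sum_range_id, Nat.choose_two_right]; simp
  | succ k ih =>
    rw [← add_assoc, Finset.sum_range_succ, ih, min_eq_right (by omega)]; ring

theorem card_multiplexEdges (hd : 2 ≤ d) (hn : d ≤ n) :
    (multiplexEdges d n).card = (d + 1).choose 2 + (n - d) * (d - 1) := by
  have h1 : multiplexEdges d n =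
      (((Finset.range (n + 1)).sigma fun b => Finset.Ico (b - (d - 2)) b).image
        fun p => (p.2, p.1)) ∪
      ((Finset.range (n - d + 1)).image (fun a => (a, a + d)) ∪
        {(0, d - 1), (n - (d - 1), n)}) := by
    ext ⟨a, b⟩
    simp only [multiplexEdges, Finset.mem_filter, Finset.mem_product, Finset.mem_range,
      Finset.mem_union, Finset.mem_image, Finset.mem_sigma, Finset.mem_Ico, Sigma.exists,
      Prod.mk.injEq, Finset.mem_insert, Finset.mem_singleton, exists_eq_right, existsAndEq,
      true_and]
    omega
  rw [h1, Finset.card_union_of_disjoint, Finset.card_union_of_disjoint,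
    Finset.card_image_of_injective, Finset.card_image_of_injective, Finset.card_pair,
    Finset.card_sigma, Finset.card_range]
  · simp only [Nat.card_Ico]
    rw [Finset.sum_congr rfl (g := fun b => min b (d - 2)) fun b hb => by omega]
    obtain ⟨m, rfl⟩ : ∃ m, d = m + 2 := ⟨d - 2, by omega⟩
    obtain ⟨k, rfl⟩ : ∃ k, n = m + 2 + k := ⟨n - (m + 2), by omega⟩
    have := sum_range_min m (k + 2)
    rw [show m + (k + 2) + 1 = m + 2 + k + 1 by ring] at this
    rw [Nat.add_sub_cancel, this, show m + 2 + k - (m + 2) = k by omega,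
      show m + 2 - 1 = m + 1 by omega]
    have e1 := Nat.choose_succ_succ' (m + 1) 1
    have e2 := Nat.choose_succ_succ' (m + 2) 1
    simp only [Nat.choose_one_right, Nat.reduceAdd, add_assoc] at e1 e2 ⊢
    rw [e2, e1]
    ring
  · intro h
    simp only [Prod.mk.injEq] at h
    omega
  · intro a a' h
    simpa using congrArg Prod.fst h
  · rintro ⟨a, b⟩ ⟨a', b'⟩ h
    simp only [Prod.mk.injEq] at h
    obtain ⟨rfl, rfl⟩ := h
    rfl
  · rw [Finset.disjoint_left]
    rintro ⟨a, b⟩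
    simp only [Finset.mem_image, Finset.mem_range, Prod.mk.injEq, Finset.mem_insert,
      Finset.mem_singleton, existsAndEq, true_and]
    omega
  · rw [Finset.disjoint_left]
    rintro ⟨a, b⟩
    simp only [Finset.mem_range,
      Finset.mem_union, Finset.mem_image, Finset.mem_sigma, Finset.mem_Ico, Sigma.exists,
      Prod.mk.injEq, Finset.mem_insert, Finset.mem_singleton, existsAndEq, true_and,
      exists_eq_right]
    omega

end MultiplexCombinatorics

/-! ### The faces of dimension at most two of a multiplex -/

section Multiplex

variable {E : Type*} {d n : ℕ} {x : Fin (n + 1) → E}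

open Classical in
/-- The indices of the points of the list `x` that belong to `F`, as natural numbers. -/
noncomputable def vertexIndices (x : Fin (n + 1) → E) (F : Set E) : Finset ℕ :=
  (Finset.range (n + 1)).filter fun j => ∃ h : j < n + 1, x ⟨j, h⟩ ∈ F

theorem mem_vertexIndices {F : Set E} {j : ℕ} :
    j ∈ vertexIndices x F ↔ ∃ h : j < n + 1, x ⟨j, h⟩ ∈ F := by
  simp only [vertexIndices, Finset.mem_filter, Finset.mem_range, and_iff_right_iff_imp]
  exact fun h => h.1

theorem val_mem_vertexIndices {F : Set E} {j : Fin (n + 1)} :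
    (j : ℕ) ∈ vertexIndices x F ↔ x j ∈ F := by
  rw [mem_vertexIndices]
  exact ⟨fun h => h.2, fun h => ⟨j.2, h⟩⟩

theorem image_vertexIndices (F : Set E) :
    (fun j : ℕ => x (Fin.ofNat (n + 1) j)) '' (vertexIndices x F : Set ℕ) =
      x '' {j | x j ∈ F} := by
  ext y
  constructor
  · rintro ⟨j, hj, rfl⟩
    obtain ⟨h, hj⟩ := mem_vertexIndices.1 hj
    have : Fin.ofNat (n + 1) j = ⟨j, h⟩ := Fin.ext (Nat.mod_eq_of_lt h)
    exact ⟨⟨j, h⟩, hj, by simp only [this]⟩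
  · rintro ⟨j, hj, rfl⟩
    exact ⟨j, val_mem_vertexIndices.2 hj, by simp⟩

variable [NormedAddCommGroup E] [NormedSpace ℝ E] {P : ConvexPolytope E}

namespace IsMultiplex

theorem mem_carrier (hP : IsMultiplex d n P x) (j : Fin (n + 1)) : x j ∈ P.carrier :=
  extremePoints_subset (𝕜 := ℝ) (hP.vertices ▸ Set.mem_range_self j)

theorem mem_facet_iff (hd : 2 ≤ d) (hP : IsMultiplex d n P x) (i j : Fin (n + 1)) :
    x j ∈ multiplexFacet d x i ↔ MultiplexIncident d n i j := by
  have hi := i.2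
  have hj := j.2
  constructor
  · intro h
    have hsub : multiplexFacet d x i ⊆ P.carrier :=
      convexHull_min (by rintro _ ⟨k, -, -, -, rfl⟩; exact hP.mem_carrier _) P.convex_carrier
    have hext : x j ∈ P.carrier.extremePoints ℝ := hP.vertices ▸ Set.mem_range_self j
    obtain ⟨k, h1, h2, h3, h4⟩ := extremePoints_convexHull_subset
      (inter_extremePoints_subset_extremePoints_of_subset hsub ⟨h, hext⟩)
    have h5 := congrArg Fin.val (hP.injective h4)
    simp only [clampIndex] at h5
    unfold MultiplexIncident
    omega
  · rintro ⟨h1, h2, h3⟩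
    -- for `i = j` the two end vertices are contributed by the clamped indices `-1` and `n + 1`
    refine subset_convexHull ℝ _ ⟨if (i : ℕ) = j then (if (i : ℕ) = 0 then -1 else n + 1) else j,
      ?_, ?_, ?_, congrArg x (Fin.ext ?_)⟩
    · split_ifs <;> omega
    · split_ifs <;> omega
    · split_ifs <;> omega
    · simp only [clampIndex]
      split_ifs <;> omega

theorem isExposed_facet (hP : IsMultiplex d n P x) (i : Fin (n + 1)) :
    IsExposed ℝ P.carrier (multiplexFacet d x i) := by
  have : multiplexFacet d x i ∈ P.facets := hP.facets ▸ Set.mem_range_self i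
  exact this.1

theorem le_iff_vertexIndices_subset (hP : IsMultiplex d n P x) {F G : P.Face} :
    F ≤ G ↔ vertexIndices x F.1 ⊆ vertexIndices x G.1 := by
  constructor
  · intro h j hj
    obtain ⟨hj, h'⟩ := mem_vertexIndices.1 hj
    exact mem_vertexIndices.2 ⟨hj, h h'⟩
  · intro h
    change F.1 ⊆ G.1
    rw [← ConvexPolytope.convexHull_image_eq hP.vertices F.2,
      ← ConvexPolytope.convexHull_image_eq hP.vertices G.2]
    refine convexHull_mono (Set.image_mono fun j hj => ?_)
    exact val_mem_vertexIndices.1 (h (val_mem_vertexIndices.2 hj))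

theorem vertexIndices_injective (hP : IsMultiplex d n P x) :
    Function.Injective fun F : P.Face => vertexIndices x F.1 := fun _ _ h =>
  le_antisymm (hP.le_iff_vertexIndices_subset.2 h.subset)
    (hP.le_iff_vertexIndices_subset.2 h.symm.subset)

theorem lt_iff_vertexIndices_ssubset (hP : IsMultiplex d n P x) {F G : P.Face} :
    F < G ↔ vertexIndices x F.1 ⊂ vertexIndices x G.1 := by
  rw [lt_iff_le_not_ge, hP.le_iff_vertexIndices_subset, hP.le_iff_vertexIndices_subset]
  rfl

/-- A face is spanned by its vertices, so `dim F + 1` is at most their number. -/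
theorem faceRank_le_card (hP : IsMultiplex d n P x) (F : P.Face) :
    P.faceRank F ≤ (vertexIndices x F.1).card := by
  classical
  have h1 := ConvexPolytope.convexHull_image_eq hP.vertices F.2
  rw [← image_vertexIndices] at h1
  have h2 : P.faceRank F = dimSucc (convexHull ℝ _) := congrArg dimSucc h1.symm
  rw [h2, dimSucc_convexHull]
  rcases (vertexIndices x F.1).eq_empty_or_nonempty with h | h
  · rw [h]; simp [dimSucc_empty]
  · rw [dimSucc_of_nonempty (by simpa using h), ← Finset.coe_image]
    obtain ⟨m, hm⟩ : ∃ m, (vertexIndices x F.1).card = m + 1 :=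
      ⟨_, (Nat.succ_pred (Finset.card_pos.2 h).ne').symm⟩
    have := finrank_vectorSpan_image_finset_le ℝ (fun j : ℕ => x (Fin.ofNat (n + 1) j))
      (vertexIndices x F.1) hm
    omega

theorem vertexIndices_topFace (hP : IsMultiplex d n P x) :
    vertexIndices x P.topFace.1 = Finset.range (n + 1) := by
  ext j
  rw [mem_vertexIndices, Finset.mem_range]
  exact ⟨fun h => h.1, fun h => ⟨h, hP.mem_carrier _⟩⟩

/-- Every combinatorial face is the vertex set of a face of the polytope. -/
theorem exists_face (hd : 2 ≤ d) (hP : IsMultiplex d n P x) {J : Finset ℕ}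
    (hJ : IsFaceIndexSet d n J) : ∃ F : P.Face, vertexIndices x F.1 = J := by
  classical
  set T : Finset (Fin (n + 1)) :=
    Finset.univ.filter fun i => ∀ k ∈ J, MultiplexIncident d n i k with hT
  have hTne : T.Nonempty := by
    obtain ⟨i, hi, h⟩ := hJ.exists_incident
    exact ⟨⟨i, by omega⟩, by simpa [hT] using h⟩
  refine ⟨⟨⋂₀ ↑(T.image (multiplexFacet d x)), IsExposed.sInter (hTne.image _) ?_⟩, ?_⟩
  · intro B hB
    obtain ⟨i, -, rfl⟩ := Finset.mem_image.1 hB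
    exact hP.isExposed_facet i
  · ext j
    have hmem : ∀ h : j < n + 1, x ⟨j, h⟩ ∈ ⋂₀ (↑(T.image (multiplexFacet d x)) : Set (Set E)) ↔
        ∀ i ∈ T, MultiplexIncident d n i j := fun h => by
      simp only [Finset.coe_image, Set.sInter_image, Set.mem_iInter, SetLike.mem_coe,
        hP.mem_facet_iff hd]
    rw [mem_vertexIndices]
    constructor
    · rintro ⟨h, hj⟩
      refine hJ.mem_of_forall (by omega) fun i hi hik => ?_
      exact (hmem h).1 hj ⟨i, by omega⟩ (by simpa [hT] using hik)
    · intro hj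
      have h : j < n + 1 := Nat.lt_succ_of_le (hJ.le j hj)
      exact ⟨h, (hmem h).2 fun i hi => (Finset.mem_filter.1 hi).2 j hj⟩

theorem faceRank_topFace (hP : IsMultiplex d n P x) : P.faceRank P.topFace = d + 1 := hP.hasDim

theorem faceRank_ne_zero {F : P.Face} (h : (vertexIndices x F.1).Nonempty) :
    P.faceRank F ≠ 0 := fun h0 => by
  rw [P.faceRank_eq_zero_iff] at h0
  obtain ⟨j, hj⟩ := h
  obtain ⟨_, hj⟩ := mem_vertexIndices.1 hj
  rw [h0] at hj
  exact hj

open Classical in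
theorem elementsBelow_topFace (hP : IsMultiplex d n P x) {r : ℕ} (hr : r ≤ d) :
    elementsBelow P.faceRank P.topFace r =
      Finset.univ.filter fun F : P.Face => P.faceRank F = r := by
  ext F
  rw [mem_elementsBelow, Finset.mem_filter]
  refine ⟨fun h => ⟨Finset.mem_univ F, h.2⟩, fun h => ⟨lt_of_le_of_ne (P.le_topFace F) ?_, h.2⟩⟩
  rintro rfl
  have := h.2
  rw [hP.faceRank_topFace] at this
  omega

/-- Faces are counted by their vertex sets. -/
theorem card_faces_eq (hP : IsMultiplex d n P x) (S : Finset P.Face) (T : Finset (Finset ℕ))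
    (h₁ : ∀ F ∈ S, vertexIndices x F.1 ∈ T) (h₂ : ∀ J ∈ T, ∃ F ∈ S, vertexIndices x F.1 = J) :
    S.card = T.card := by
  classical
  rw [← Finset.card_image_of_injective S hP.vertexIndices_injective]
  congr 1
  ext J
  rw [Finset.mem_image]
  refine ⟨?_, h₂ J⟩
  rintro ⟨F, hF, rfl⟩
  exact h₁ F hF

variable [FiniteDimensional ℝ E]

theorem isFaceIndexSet_vertexIndices (hd : 2 ≤ d) (hP : IsMultiplex d n P x) {F : P.Face}
    (hne : F.1.Nonempty) (hF : F ≠ P.topFace) : IsFaceIndexSet d n (vertexIndices x F.1) := by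
  have hFP : F.1 ≠ P.carrier := fun h => hF (Subtype.ext h)
  have key : ∀ y ∉ F.1, ∃ i : Fin (n + 1), F.1 ⊆ multiplexFacet d x i ∧
      y ∉ multiplexFacet d x i := fun y hy => by
    obtain ⟨G, hG, h1, h2⟩ := P.exists_facet_notMem F.2 hne hFP hy
    rw [hP.facets] at hG
    obtain ⟨i, rfl⟩ := hG
    exact ⟨i, h1, h2⟩
  have hinc : ∀ i : Fin (n + 1), F.1 ⊆ multiplexFacet d x i →
      ∀ k ∈ vertexIndices x F.1, MultiplexIncident d n i k := fun i hi k hk => by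
    obtain ⟨h, hk⟩ := mem_vertexIndices.1 hk
    exact (hP.mem_facet_iff hd i ⟨k, h⟩).1 (hi hk)
  refine ⟨fun j hj => Nat.le_of_lt_succ (mem_vertexIndices.1 hj).1, ?_, fun j hj hjF => ?_⟩
  · obtain ⟨y, -, hy⟩ := Set.exists_of_ssubset (F.2.subset.ssubset_of_ne hFP)
    obtain ⟨i, hi, -⟩ := key y hy
    exact ⟨i, Nat.le_of_lt_succ i.2, hinc i hi⟩
  · have hj' : j < n + 1 := Nat.lt_succ_of_le hj
    obtain ⟨i, hi, hij⟩ := key (x ⟨j, hj'⟩) fun h => hjF (mem_vertexIndices.2 ⟨hj', h⟩)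
    exact ⟨i, Nat.le_of_lt_succ i.2, hinc i hi,
      fun h => hij ((hP.mem_facet_iff hd i ⟨j, hj'⟩).2 h)⟩

theorem isFaceIndexSet_of_faceRank (hd : 2 ≤ d) (hP : IsMultiplex d n P x) {F : P.Face}
    (h0 : P.faceRank F ≠ 0) (h1 : P.faceRank F ≤ d) :
    IsFaceIndexSet d n (vertexIndices x F.1) := by
  refine hP.isFaceIndexSet_vertexIndices hd ?_ ?_
  · rw [Set.nonempty_iff_ne_empty]
    exact fun h => h0 (dimSucc_eq_zero_iff.2 h)
  · rintro rfl
    rw [hP.faceRank_topFace] at h1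
    omega

theorem faceRank_eq_one_iff (hP : IsMultiplex d n P x) {F : P.Face} :
    P.faceRank F = 1 ↔ (vertexIndices x F.1).card = 1 := by
  have hle := hP.faceRank_le_card F
  constructor
  · intro h
    have hsub := subsingleton_of_dimSucc_eq_one h
    refine le_antisymm (Finset.card_le_one.2 fun i hi j hj => ?_) (by omega)
    obtain ⟨hi, hi'⟩ := mem_vertexIndices.1 hi
    obtain ⟨hj, hj'⟩ := mem_vertexIndices.1 hj
    simpa using hP.injective (hsub hi' hj')
  · intro h
    have h0 := faceRank_ne_zero (x := x) (F := F) (Finset.card_pos.1 (by omega))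
    omega

theorem faceRank_eq_two_of_card (hP : IsMultiplex d n P x) {F : P.Face}
    (h : (vertexIndices x F.1).card = 2) : P.faceRank F = 2 := by
  have hle := hP.faceRank_le_card F
  have h1 := (hP.faceRank_eq_one_iff (F := F)).not.2 (by omega)
  have h0 := faceRank_ne_zero (x := x) (F := F) (Finset.card_pos.1 (by omega))
  omega

theorem faceRank_eq_two_iff (hd : 2 ≤ d) (hP : IsMultiplex d n P x) {F : P.Face} :
    P.faceRank F = 2 ↔ (vertexIndices x F.1).card = 2 := by
  refine ⟨fun h => ?_, hP.faceRank_eq_two_of_card⟩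
  have hle := hP.faceRank_le_card F
  obtain ⟨a, b, hab, hsub, hcl⟩ :=
    (hP.isFaceIndexSet_of_faceRank hd (F := F) (by omega) (by omega)).exists_pair hd (by omega)
  obtain ⟨G, hG⟩ := hP.exists_face hd hcl
  have hcard := Finset.card_pair hab.ne
  have hG2 : P.faceRank G = 2 := hP.faceRank_eq_two_of_card (by rw [hG, hcard])
  by_contra hne
  have hlt : G < F := by
    rw [hP.lt_iff_vertexIndices_ssubset, hG]
    exact hsub.ssubset_of_ne fun h => hne (by rw [← h, hcard])
  have := P.faceRank_strictMono hlt
  omega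

theorem card_of_faceRank_eq_three (hd : 3 ≤ d) (hP : IsMultiplex d n P x) {F : P.Face}
    (hF : P.faceRank F = 3) : (vertexIndices x F.1).card = 3 ∨
      ∃ a, a + d < n ∧ vertexIndices x F.1 = multiplexWindow d n a 1 := by
  have hle := hP.faceRank_le_card F
  by_cases h3 : (vertexIndices x F.1).card = 3
  · exact Or.inl h3
  · right
    rcases (hP.isFaceIndexSet_of_faceRank (by omega) (F := F) (by omega)
      (by omega)).exists_chain hd (by omega) with h | ⟨a, b, K, hab, h1, h2, h3, h4⟩
    · exact h
    · obtain ⟨G, hG⟩ := hP.exists_face (by omega) h1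
      obtain ⟨H, hH⟩ := hP.exists_face (by omega) h2
      rw [← hG, ← hH, ← hP.lt_iff_vertexIndices_ssubset] at h3
      rw [← hH, ← hP.lt_iff_vertexIndices_ssubset] at h4
      have h5 := hP.faceRank_eq_two_of_card (F := G) (by rw [hG, Finset.card_pair hab.ne])
      have h6 := P.faceRank_strictMono h3
      have h7 := P.faceRank_strictMono h4
      omega

/-- The windows with `k, k + 1, …, d - 2` form a chain of proper faces, which bounds the dimension
of the first one. -/
theorem faceRank_window_le (hd : 2 ≤ d) (hP : IsMultiplex d n P x) {a k : ℕ} (ha : a + d ≤ n)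
    (hk : k + 2 ≤ d) {F : P.Face} (hF : vertexIndices x F.1 = multiplexWindow d n a k) :
    P.faceRank F ≤ k + 2 := by
  induction hm : d - 2 - k generalizing k F with
  | zero =>
    have hlt : F < P.topFace := by
      rw [hP.lt_iff_vertexIndices_ssubset, hF, hP.vertexIndices_topFace,
        Finset.ssubset_iff_of_subset fun j => by
          simp only [mem_multiplexWindow, Finset.mem_range]; omega]
      refine ⟨a + k + 1, ?_, ?_⟩
      · rw [Finset.mem_range]; omega
      · rw [mem_multiplexWindow]; omega
    have := P.faceRank_strictMono hlt
    rw [hP.faceRank_topFace] at this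
    omega
  | succ m ih =>
    obtain ⟨G, hG⟩ := hP.exists_face hd (isFaceIndexSet_window (a := a) (k := k + 1)
      (by omega) ha)
    have h1 := ih (by omega) hG (by omega)
    have hlt : F < G := by
      rw [hP.lt_iff_vertexIndices_ssubset, hF, hG]
      exact multiplexWindow_ssubset_succ (by omega) ha
    have := P.faceRank_strictMono hlt
    omega

theorem faceRank_window_one (hd : 3 ≤ d) (hP : IsMultiplex d n P x) {a : ℕ} (ha : a + d < n)
    {F : P.Face} (hF : vertexIndices x F.1 = multiplexWindow d n a 1) : P.faceRank F = 3 := by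
  have hle := hP.faceRank_window_le (by omega) (by omega) (by omega) hF
  have hcl := isFaceIndexSet_window (d := d) (n := n) (a := a) (k := 0) (by omega) (by omega)
  obtain ⟨G, hG⟩ := hP.exists_face (by omega) hcl
  have hlt : G < F := by
    rw [hP.lt_iff_vertexIndices_ssubset, hF, hG]
    exact multiplexWindow_ssubset_succ (by omega) (by omega)
  have h1 := P.faceRank_strictMono hlt
  have h2 := hP.faceRank_eq_two_of_card (F := G)
    (by rw [hG, multiplexWindow_zero (by omega), Finset.card_pair (by omega)])
  omega

theorem card_faces_below_rank_one (hd : 2 ≤ d) (hn : d ≤ n) (hP : IsMultiplex d n P x)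
    {F : P.Face} (hF : 2 ≤ P.faceRank F) :
    (elementsBelow P.faceRank F 1).card = (vertexIndices x F.1).card := by
  rw [← Finset.card_image_of_injective (vertexIndices x F.1)
    (Finset.singleton_injective (α := ℕ))]
  refine hP.card_faces_eq _ _ (fun G hG => ?_) fun J hJ => ?_
  · obtain ⟨h1, h2⟩ := mem_elementsBelow.1 hG
    obtain ⟨j, hj⟩ := Finset.card_eq_one.1 (hP.faceRank_eq_one_iff.1 h2)
    rw [hj]
    refine Finset.mem_image_of_mem _ ?_
    have := hP.le_iff_vertexIndices_subset.1 h1.le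
    exact this (by rw [hj]; exact Finset.mem_singleton_self j)
  · obtain ⟨j, hj, rfl⟩ := Finset.mem_image.1 hJ
    have hjn : j ≤ n := Nat.le_of_lt_succ (mem_vertexIndices.1 hj).1
    obtain ⟨G, hG⟩ := hP.exists_face hd (isFaceIndexSet_singleton hd hn hjn)
    have hG1 : P.faceRank G = 1 := hP.faceRank_eq_one_iff.2 (by rw [hG, Finset.card_singleton])
    refine ⟨G, mem_elementsBelow.2 ⟨lt_of_le_of_ne ?_ ?_, hG1⟩, hG⟩
    · rw [hP.le_iff_vertexIndices_subset, hG]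
      simpa using hj
    · rintro rfl
      omega

theorem card_edges (hd : 2 ≤ d) (hn : d ≤ n) (hP : IsMultiplex d n P x) :
    (elementsBelow P.faceRank P.topFace 2).card = (d + 1).choose 2 + (n - d) * (d - 1) := by
  have hinj : Set.InjOn (fun p : ℕ × ℕ => ({p.1, p.2} : Finset ℕ)) (multiplexEdges d n) := by
    rintro ⟨a, b⟩ hp ⟨a', b'⟩ hp' h
    have h1 := (Finset.mem_filter.1 hp).2.1
    have h2 := (Finset.mem_filter.1 hp').2.1
    simp only at h1 h2 h
    have ha : a ∈ ({a', b'} : Finset ℕ) := h ▸ by simp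
    have hb : b ∈ ({a', b'} : Finset ℕ) := h ▸ by simp
    simp only [Finset.mem_insert, Finset.mem_singleton] at ha hb
    rw [Prod.mk.injEq]
    omega
  rw [← card_multiplexEdges hd hn, ← Finset.card_image_of_injOn hinj]
  refine hP.card_faces_eq _ _ (fun F hF => ?_) fun J hJ => ?_
  · have h2 := (mem_elementsBelow.1 hF).2
    have hcl := hP.isFaceIndexSet_of_faceRank hd (F := F) (by omega) (by omega)
    obtain ⟨a, b, hab, hsub, -⟩ :=
      hcl.exists_pair hd ((hP.faceRank_eq_two_iff hd).1 h2).ge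
    have heq := Finset.eq_of_subset_of_card_le hsub
      (by rw [Finset.card_pair hab.ne, (hP.faceRank_eq_two_iff hd).1 h2])
    rw [← heq] at hcl
    have hbn : b ≤ n := hcl.le b (by simp)
    rw [isFaceIndexSet_pair_iff hd hn hab hbn] at hcl
    refine Finset.mem_image.2 ⟨(a, b), ?_, heq⟩
    simp only [multiplexEdges, Finset.mem_filter, Finset.mem_product, Finset.mem_range]
    omega
  · obtain ⟨⟨a, b⟩, hp, rfl⟩ := Finset.mem_image.1 hJ
    simp only [multiplexEdges, Finset.mem_filter, Finset.mem_product, Finset.mem_range] at hp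
    obtain ⟨F, hF⟩ := hP.exists_face hd
      ((isFaceIndexSet_pair_iff hd hn hp.2.1 (by omega)).2 hp.2.2)
    have h2 : P.faceRank F = 2 :=
      hP.faceRank_eq_two_of_card (by rw [hF]; exact Finset.card_pair hp.2.1.ne)
    refine ⟨F, mem_elementsBelow.2 ⟨lt_of_le_of_ne (P.le_topFace F) ?_, h2⟩, hF⟩
    rintro rfl
    rw [hP.faceRank_topFace] at h2
    omega

open Classical in
/-- A multiplex has exactly `n - d` quadrilateral faces, and its other `2`-faces are triangles. -/
theorem sum_card_sub_three (hd : 2 ≤ d) (hn : d ≤ n) (hP : IsMultiplex d n P x) :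
    ∑ F ∈ Finset.univ.filter (fun F : P.Face => P.faceRank F = 3),
      ((elementsBelow P.faceRank F 1).card - 3 : ℤ) = n - d := by
  rw [Finset.sum_congr rfl (g := fun F : P.Face => ((vertexIndices x F.1).card - 3 : ℤ)) fun F hF =>
    by rw [hP.card_faces_below_rank_one hd hn (by simp at hF; omega)]]
  rcases hd.eq_or_lt with rfl | hd'
  · -- the polygon itself is the only two-dimensional face
    have : Finset.univ.filter (fun F : P.Face => P.faceRank F = 3) = {P.topFace} := by
      ext F
      simp only [Finset.mem_filter, Finset.mem_univ, true_and, Finset.mem_singleton]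
      constructor
      · intro h
        by_contra hne
        have := P.faceRank_strictMono (lt_of_le_of_ne (P.le_topFace F) hne)
        rw [hP.faceRank_topFace] at this
        omega
      · rintro rfl
        exact hP.faceRank_topFace
    rw [this, Finset.sum_singleton, hP.vertexIndices_topFace, Finset.card_range]
    push_cast
    ring
  · have hquad : ∀ F : P.Face, P.faceRank F = 3 → ((vertexIndices x F.1).card - 3 : ℤ) =
        if (vertexIndices x F.1).card = 4 then 1 else 0 := fun F hF => by
      rcases hP.card_of_faceRank_eq_three hd' hF with h | ⟨a, ha, h⟩
      · simp [h]
      · rw [h, card_multiplexWindow_one hd' ha]; simp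
    rw [Finset.sum_congr rfl fun F hF => hquad F (Finset.mem_filter.1 hF).2, Finset.sum_boole]
    have hinj : Set.InjOn (fun a => multiplexWindow d n a 1) (Finset.range (n - d)) := by
      intro a ha b hb h
      simp only [Finset.coe_range, Set.mem_Iio] at ha hb
      have h1 : a ∈ multiplexWindow d n b 1 := by
        rw [← show _ = multiplexWindow d n b 1 from h, mem_multiplexWindow]; omega
      have h2 : b ∈ multiplexWindow d n a 1 := by
        rw [show multiplexWindow d n a 1 = _ from h, mem_multiplexWindow]; omega
      rw [mem_multiplexWindow] at h1 h2
      omega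
    rw [hP.card_faces_eq _ ((Finset.range (n - d)).image fun a => multiplexWindow d n a 1),
      Finset.card_image_of_injOn hinj, Finset.card_range, Nat.cast_sub hn]
    · intro F hF
      simp only [Finset.mem_filter, Finset.mem_univ, true_and] at hF
      rcases hP.card_of_faceRank_eq_three hd' hF.1 with h | ⟨a, ha, h⟩
      · omega
      · exact Finset.mem_image.2 ⟨a, by rw [Finset.mem_range]; omega, h.symm⟩
    · intro J hJ
      obtain ⟨a, ha, rfl⟩ := Finset.mem_image.1 hJ
      rw [Finset.mem_range] at ha
      obtain ⟨F, hF⟩ := hP.exists_face hd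
        (isFaceIndexSet_window (a := a) (k := 1) (by omega) (by omega))
      refine ⟨F, ?_, hF⟩
      simp only [Finset.mem_filter, Finset.mem_univ, true_and]
      exact ⟨hP.faceRank_window_one hd' (by omega) hF,
        by rw [hF, card_multiplexWindow_one hd' (by omega)]⟩

theorem isBottomRanked (P : ConvexPolytope E) : IsBottomRanked P.faceRank P.botFace :=
  ⟨P.faceRank_strictMono, P.botFace_le, P.faceRank_eq_zero_iff⟩

end IsMultiplex

open Classical in
theorem ConvexPolytope.faceNumber_eq_card (P : ConvexPolytope E) (i : ℕ) :
    P.faceNumber i = (Finset.univ.filter fun F : P.Face => P.faceRank F = i + 1).card := by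
  rw [ConvexPolytope.faceNumber, Nat.card_eq_fintype_card, Fintype.card_subtype]

open Classical in
theorem ConvexPolytope.flagNumber_eq_sum (P : ConvexPolytope E) (i j : ℕ) :
    P.flagNumber i j = ∑ F ∈ Finset.univ.filter (fun F : P.Face => P.faceRank F = j + 1),
      (elementsBelow P.faceRank F (i + 1)).card := by
  rw [ConvexPolytope.flagNumber, Nat.card_eq_fintype_card, Fintype.card_subtype,
    Finset.card_eq_sum_card_fiberwise (f := Prod.snd)
      (t := Finset.univ.filter (fun F : P.Face => P.faceRank F = j + 1))]
  · refine Finset.sum_congr rfl fun F hF => ?_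
    refine Finset.card_bij (fun p _ => p.1) ?_ ?_ ?_
    · rintro ⟨G, F'⟩ h
      simp only [Finset.mem_filter, Finset.mem_univ, true_and] at h
      obtain ⟨h, rfl⟩ := h
      exact mem_elementsBelow.2 ⟨h.1, h.2.1⟩
    · rintro ⟨G, F₁⟩ h₁ ⟨G', F₂⟩ h₂ h
      simp only [Finset.mem_filter, Finset.mem_univ, true_and] at h₁ h₂
      exact Prod.ext h (h₁.2.trans h₂.2.symm)
    · intro G hG
      refine ⟨(G, F), ?_, rfl⟩
      simp only [Finset.mem_filter, Finset.mem_univ, true_and] at hF ⊢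
      have := mem_elementsBelow.1 hG
      exact ⟨⟨this.1, this.2, hF⟩, trivial⟩
  · rintro ⟨G, F⟩ h
    simp at h ⊢
    exact h.2.2

end Multiplex

theorem mainTheorem10 (d n N : ℕ) (hd : 2 ≤ d) (hn : d ≤ n)
    (P : ConvexPolytope (EuclideanSpace ℝ (Fin N))) (x : Fin (n + 1) → EuclideanSpace ℝ (Fin N))
    (hP : IsMultiplex d n P x) :
    (3 ≤ d ∨ n = d → P.toricH d 1 = P.toricH d 2) ∧
    (P.flagNumber 0 2 : ℤ) - 3 * (P.faceNumber 2 : ℤ) + (P.faceNumber 1 : ℤ)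
      - (d : ℤ) * (P.faceNumber 0 : ℤ) + ((d + 1).choose 2 : ℤ) = 0 := by
  classical
  have hsum := hP.sum_card_sub_three hd hn
  have hedges := hP.card_edges hd hn
  have hverts : (elementsBelow P.faceRank P.topFace 1).card = n + 1 := by
    rw [hP.card_faces_below_rank_one hd hn (by rw [hP.faceRank_topFace]; omega),
      hP.vertexIndices_topFace, Finset.card_range]
  have hedges' : ((elementsBelow P.faceRank P.topFace 2).card : ℤ) =
      (d + 1).choose 2 + (n - d) * (d - 1) := by
    rw [hedges]
    push_cast [Nat.cast_sub hn, Nat.cast_sub (show 1 ≤ d by omega)]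
    ring
  have hchoose : (2 * (d + 1).choose 2 : ℤ) = d * (d + 1) := by
    have h2 := Nat.choose_two_right (d + 1)
    have h3 := Nat.even_mul_pred_self (d + 1)
    have h4 := Nat.div_mul_cancel h3.two_dvd
    rw [← h2] at h4
    have h5 : (((d + 1).choose 2 * 2 : ℕ) : ℤ) = ((d + 1) * d : ℕ) := by exact_mod_cast h4
    push_cast at h5
    linarith
  constructor
  · intro hcase
    have hrank := hP.faceRank_topFace
    obtain ⟨e, rfl⟩ : ∃ e, d = e + 2 := ⟨d - 2, by omega⟩
    have h1 : P.toricH (e + 2) 1 = _ :=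
      (IsMultiplex.isBottomRanked P).coeff_toricF_succ (d := e + 1) hrank
    have h2 : P.toricH (e + 2) 2 = _ :=
      (IsMultiplex.isBottomRanked P).coeff_toricF_succ_succ (d := e) hrank
    have hsum' : ∑ F ∈ elementsBelow P.faceRank P.topFace 3,
        ((elementsBelow P.faceRank F 1).card - 3 : ℤ) = n - (e + 2) := by
      rcases hcase with h | h
      · rw [hP.elementsBelow_topFace h, hsum]
        push_cast
        ring
      · rcases Nat.lt_or_ge 2 (e + 2) with h' | h'
        · rw [hP.elementsBelow_topFace h', hsum]
          push_cast
          ring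
        · obtain rfl : e = 0 := by omega
          rw [Finset.sum_eq_zero, h]
          · norm_num
          · intro F hF
            obtain ⟨h3, h4⟩ := mem_elementsBelow.1 hF
            have := P.faceRank_strictMono h3
            omega
    have hpascal : ((e + 3).choose 2 : ℤ) = (e + 2) + (e + 2).choose 2 := by
      have := Nat.choose_succ_succ' (e + 2) 1
      rw [Nat.choose_one_right] at this
      exact_mod_cast this
    rw [h1, h2, hsum', hedges', hverts]
    push_cast at hchoose ⊢
    linear_combination hpascal - hchoose
  · rw [P.flagNumber_eq_sum, P.faceNumber_eq_card, P.faceNumber_eq_card, P.faceNumber_eq_card,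
      ← hP.elementsBelow_topFace (r := 1 + 1) hd,
      ← hP.elementsBelow_topFace (r := 0 + 1) (by omega), hedges', hverts]
    rw [Finset.sum_sub_distrib, Finset.sum_const, nsmul_eq_mul] at hsum
    push_cast at hsum ⊢
    linear_combination hsum + hchoose
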